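/- A dyadic grid on $\mathbb R$ is a collection $\mathcal D$ of intervals such that every $I\in\mathcal D$ has length $|I|=2^k$ for some $k\in\mathbb Z$, for each $k\in\mathbb Z$ the intervals in $\mathcal D$ of length $2^k$ form a partition of $\mathbb R$, and $I\cap J\in\{\varnothing,I,J\}$ for all $I,J\in\mathcal D$. For $I\in\mathcal D$ with left half $I_-$ and right half $I_+$ let $h_I=|I|^{-1/2}(\mathbf 1_{I_+}-\mathbf 1_{I_-})$ be the Haar function, and for real-valued $f\in L^2(\mathbb R)$ write $(f,h_I)=\int_{\mathbb R} f\,h_I\,dx$. For $s>0$ let $$D^s_{\mathcal D}f=\sum_{I\in\mathcal D}|I|^{-s}(f,h_I)\,h_I ,\qquad H^s_{\mathcal D}(\mathbb R)=\{f\in L^2(\mathbb R): D^s_{\mathcal D}f\in L^2(\mathbb R)\},$$ where $D^s_{\mathcal D}f\in L^2(\mathbb R)$ means that the series converges unconditionally in $L^2(\mathbb R)$, and $$\|f\|_{H^s_{\mathcal D}}=\big(\|D^s_{\mathcal D}f\|_{L^2}^2+\|f\|_{L^2}^2\big)^{1/2}.$$ **Proposition.** Let $1/2<s<1$. Then for every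 dyadic grid $\mathcal D$ the space $H^s_{\mathcal D}(\mathbb R)$ is an algebra under pointwise multiplication: if $f\in H^s_{\mathcal D}(\mathbb R)$ then $f^2\in H^s_{\mathcal D}(\mathbb R)$, and if $f_1,f_2\in H^s_{\mathcal D}(\mathbb R)$ then $f_1f_2\in H^s_{\mathcal D}(\mathbb R)$. Moreover there is a constant $C_s>0$ depending only on $s$ (not on $\mathcal D$ or $f$) such that $$\|f^2\|_{H^s_{\mathcal D}}\le C_s\,\|f\|_{H^s_{\mathcal D}}^2\qquad\text{for all } f\in H^s_{\mathcal D}(\mathbb R).$$ -/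

import Mathlib

open MeasureTheory

/-- A dyadic grid on `ℝ`: a collection of intervals of dyadic lengths such that, for each `k : ℤ`,
those of length `2 ^ k` partition `ℝ`, and any two are disjoint or nested. -/
structure DyadicGrid where
  intervals : Set (Set ℝ)
  interval_of_mem : ∀ I ∈ intervals, I.OrdConnected
  length_of_mem : ∀ I ∈ intervals, ∃ k : ℤ, volume I = ENNReal.ofReal ((2 : ℝ) ^ k)
  partition : ∀ k : ℤ,
    Setoid.IsPartition {I | I ∈ intervals ∧ volume I = ENNReal.ofReal ((2 : ℝ) ^ k)}
  nested : ∀ I ∈ intervals, ∀ J ∈ intervals, I ∩ J = ∅ ∨ I ∩ J = I ∨ I ∩ J = J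

namespace DyadicGrid

noncomputable section

/-- The midpoint of a bounded interval. -/
def midpt (I : Set ℝ) : ℝ := (sInf I + sSup I) / 2

/-- The left half of an interval. The midpoint is put in neither half: it is a null set,
and Haar functions are only used as elements of `L²`. -/
def leftHalf (I : Set ℝ) : Set ℝ := I ∩ Set.Iio (midpt I)

/-- The right half of an interval. -/
def rightHalf (I : Set ℝ) : Set ℝ := I ∩ Set.Ioi (midpt I)

/-- The Haar function `h_I = |I|^{-1/2} (1_{I_+} - 1_{I_-})`. -/
def haar (I : Set ℝ) (x : ℝ) : ℝ :=
  (Real.sqrt (volume.real I))⁻¹ *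
    ((rightHalf I).indicator (fun _ => (1 : ℝ)) x - (leftHalf I).indicator (fun _ => (1 : ℝ)) x)

theorem memLp_haar (D : DyadicGrid) (I : D.intervals) : MemLp (haar (I : Set ℝ)) 2 volume := by
  obtain ⟨k, hk⟩ := D.length_of_mem I I.2
  have hm : MeasurableSet (I : Set ℝ) := (D.interval_of_mem I I.2).measurableSet
  have hfin : volume (I : Set ℝ) ≠ ⊤ := by rw [hk]; exact ENNReal.ofReal_ne_top
  have h1 : MemLp ((rightHalf (I : Set ℝ)).indicator (fun _ => (1 : ℝ))) 2 volume :=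
    memLp_indicator_const 2 (hm.inter measurableSet_Ioi) 1
      (Or.inr (measure_ne_top_of_subset Set.inter_subset_left hfin))
  have h2 : MemLp ((leftHalf (I : Set ℝ)).indicator (fun _ => (1 : ℝ))) 2 volume :=
    memLp_indicator_const 2 (hm.inter measurableSet_Iio) 1
      (Or.inr (measure_ne_top_of_subset Set.inter_subset_left hfin))
  exact (h1.sub h2).const_mul _

/-- The Haar function `h_I` as an element of `L²(ℝ)`. -/
def haarLp (D : DyadicGrid) (I : D.intervals) : Lp ℝ 2 (volume : Measure ℝ) :=
  (D.memLp_haar I).toLp (haar (I : Set ℝ))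

/-- The Haar coefficient `(f, h_I) = ∫ f h_I`. -/
def haarCoeff (f : Lp ℝ 2 (volume : Measure ℝ)) (I : Set ℝ) : ℝ := ∫ x, f x * haar I x

/-- The term `|I|^{-s} (f, h_I) h_I` of the series defining the dyadic fractional derivative. -/
def fracDerivTerm (D : DyadicGrid) (s : ℝ) (f : Lp ℝ 2 (volume : Measure ℝ)) (I : D.intervals) :
    Lp ℝ 2 (volume : Measure ℝ) :=
  (volume.real (I : Set ℝ) ^ (-s) * haarCoeff f I) • D.haarLp I

/-- The dyadic fractional derivative `D^s f = ∑_I |I|^{-s} (f, h_I) h_I`, the sum being taken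
in `L²(ℝ)`. It is meaningful for `f` in `D.sobolev s`. -/
def fracDeriv (D : DyadicGrid) (s : ℝ) (f : Lp ℝ 2 (volume : Measure ℝ)) :
    Lp ℝ 2 (volume : Measure ℝ) :=
  ∑' I : D.intervals, D.fracDerivTerm s f I

theorem haarCoeff_eq_inner (D : DyadicGrid) (f : Lp ℝ 2 (volume : Measure ℝ)) (I : D.intervals) :
    haarCoeff f I = inner ℝ (D.haarLp I) f := by
  rw [L2.inner_def, haarCoeff]
  refine integral_congr_ae ?_
  filter_upwards [(D.memLp_haar I).coeFn_toLp] with x hx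
  simp [haarLp, hx]

/-- The dyadic fractional Sobolev space: all `f ∈ L²(ℝ)` for which `D^s f` is in `L²(ℝ)`, that is,
for which the series defining `D^s f` converges (unconditionally) in `L²(ℝ)`. -/
def sobolev (D : DyadicGrid) (s : ℝ) : Submodule ℝ (Lp ℝ 2 (volume : Measure ℝ)) where
  carrier := {f | Summable (D.fracDerivTerm s f)}
  zero_mem' := by
    have h : D.fracDerivTerm s 0 = fun _ => 0 := by
      funext I
      simp [fracDerivTerm, haarCoeff_eq_inner]
    change Summable (D.fracDerivTerm s 0)
    rw [h]
    exact summable_zero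
  add_mem' := by
    intro f g hf hg
    have h : D.fracDerivTerm s (f + g) = fun I => D.fracDerivTerm s f I + D.fracDerivTerm s g I := by
      funext I
      simp [fracDerivTerm, haarCoeff_eq_inner, inner_add_right, mul_add, add_smul]
    change Summable (D.fracDerivTerm s (f + g))
    rw [h]
    exact Summable.add hf hg
  smul_mem' := by
    intro c f hf
    have h : D.fracDerivTerm s (c • f) = fun I => c • D.fracDerivTerm s f I := by
      funext I
      simp only [fracDerivTerm, haarCoeff_eq_inner, inner_smul_right, smul_smul]
      congr 1
      ring
    change Summable (D.fracDerivTerm s (c • f))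
    rw [h]
    exact Summable.const_smul c hf

/-- The norm `(‖D^s f‖² + ‖f‖²)^{1/2}` of `f` in `D.sobolev s`, with `L²` norms on the right. -/
def sobolevNorm (D : DyadicGrid) (s : ℝ) (f : Lp ℝ 2 (volume : Measure ℝ)) : ℝ :=
  Real.sqrt (‖D.fracDeriv s f‖ ^ 2 + ‖f‖ ^ 2)

end

end DyadicGrid

/-!
Since `h_I` is supported in `I` and has mean zero, the Haar coefficient of `f₁ f₂` on `I` does not
change when `f₁ f₂` is replaced by `(f₁ f₂ - a₁ a₂) 1_I`, where `aᵢ` is the average of `fᵢ` on `I`.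
It is therefore at most `‖f₁‖_∞ osc(f₂, I) + ‖f₂‖_∞ osc(f₁, I)`, where `osc(f, I)` is the `L²(I)`
norm of `f - ⨍_I f`. As the Haar functions form an orthonormal basis of `L²(ℝ)`, `osc(f, I)²` is the
sum of `(f, h_J)²` over `J ⊆ I`; summing `|I|^{-2s} osc(f, I)²` over `I` and exchanging the sums
leaves, for each `J`, a geometric series over the ancestors of `J`, and the total is a constant
multiple of `‖D^s f‖²`.

The sup norms are controlled through `|(f, h_I)| ≤ |I|^s ‖D^s f‖`: passing from `I` to one of its
halves changes the average of `f` by `|I|^{-1/2} |(f, h_I)|`, so for `s > 1/2` the averages over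
the intervals of length `2⁻ⁿ` containing a point converge geometrically. The same formula for the
increments shows that the Haar system is complete: if all Haar coefficients vanish, averages do not
depend on the scale, and by Cauchy-Schwarz they tend to zero over large intervals.
-/

open Filter Topology

section General

theorem hasSum_comm_of_nonneg {ι κ : Type*} {f : ι → κ → ℝ} (hf : ∀ i j, 0 ≤ f i j)
    {r : ι → ℝ} {c : κ → ℝ} {a : ℝ} (hr : ∀ i, HasSum (f i) (r i))
    (hc : ∀ j, HasSum (fun i => f i j) (c j)) (ha : HasSum r a) : HasSum c a := by
  have hsum : Summable (Function.uncurry f) :=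
    (summable_prod_of_nonneg fun p => hf p.1 p.2).2
      ⟨fun i => (hr i).summable, ha.summable.congr fun i => (hr i).tsum_eq.symm⟩
  have h : HasSum (Function.uncurry f) a := by
    simpa only [(hsum.hasSum.prod_fiberwise hr).unique ha] using hsum.hasSum
  exact ((Equiv.prodComm κ ι).hasSum_iff.2 h).prod_fiberwise hc

theorem hasSum_rpow_two_pow_mul_sq {s : ℝ} (hs : 0 < s) {v : ℝ} (hv : 0 ≤ v) :
    HasSum (fun n : ℕ => ((2 ^ n * v) ^ (-s)) ^ 2)
      ((1 - (2 : ℝ) ^ (-2 * s))⁻¹ * (v ^ (-s)) ^ 2) := by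
  have hterm : ∀ n : ℕ, ((2 ^ n * v) ^ (-s)) ^ 2 = ((2 : ℝ) ^ (-2 * s)) ^ n * (v ^ (-s)) ^ 2 := by
    intro n
    rw [Real.mul_rpow (by positivity) hv, mul_pow]
    simp only [← Real.rpow_natCast, ← Real.rpow_mul zero_le_two]
    congr 2
    push_cast
    ring
  simp only [hterm]
  refine (hasSum_geometric_of_lt_one (by positivity) ?_).mul_right _
  exact Real.rpow_lt_one_of_one_lt_of_neg one_lt_two (by linarith)

theorem abs_mul_sub_mul_le (x y a b : ℝ) :
    |x * y - a * b| ≤ |x| * |y - b| + |b| * |x - a| := by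
  calc |x * y - a * b| = |x * (y - b) + b * (x - a)| := by
        congr 1
        ring
    _ ≤ |x| * |y - b| + |b| * |x - a| := by
        simpa only [abs_mul] using abs_add_le (x * (y - b)) (b * (x - a))

theorem lt_of_disjoint_of_ordConnected {α : Type*} [LinearOrder α] {s t : Set α}
    (hs : s.OrdConnected) (ht : t.OrdConnected) (h : Disjoint s t) {x y : α} (hx : x ∈ s)
    (hy : y ∈ t) (hxy : x < y) : ∀ a ∈ s, ∀ b ∈ t, a < b := by
  intro a ha b hb
  by_contra! hba
  rw [Set.disjoint_left] at h
  rcases le_total a y with hay | hya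
  · exact h ha (ht.out hb hy ⟨hba, hay⟩)
  · exact h (hs.out hx ha ⟨hxy.le, hya⟩) hy

variable {α : Type*} [MeasurableSpace α] {μ : Measure α}

theorem norm_average_le_of_norm_le_ae {E : Type*} [NormedAddCommGroup E] [NormedSpace ℝ E]
    [IsFiniteMeasure μ] [NeZero μ] {f : α → E} {C : ℝ} (h : ∀ᵐ x ∂μ, ‖f x‖ ≤ C) :
    ‖⨍ x, f x ∂μ‖ ≤ C := by
  have hpos : 0 < μ.real Set.univ := measureReal_univ_pos
  rw [average_eq, norm_smul, norm_inv, Real.norm_of_nonneg hpos.le, inv_mul_le_iff₀ hpos,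
    mul_comm]
  exact norm_integral_le_of_norm_le_const h

theorem abs_setAverage_le_norm (f : Lp ℝ 2 μ) {s : Set α} (hs : MeasurableSet s)
    (hμs : μ s ≠ ⊤) : |⨍ x in s, f x ∂μ| ≤ (√(μ.real s))⁻¹ * ‖f‖ := by
  have cauchy_schwarz : |∫ x in s, f x ∂μ| ≤ √(μ.real s) * ‖f‖ := by
    have h := abs_real_inner_le_norm (indicatorConstLp 2 hs hμs (1 : ℝ)) f
    rw [L2.inner_indicatorConstLp_one, norm_indicatorConstLp two_ne_zero ENNReal.ofNat_ne_top]
      at h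
    simpa [Real.sqrt_eq_rpow] using h
  rw [setAverage_eq, smul_eq_mul, abs_mul, abs_of_nonneg (inv_nonneg.2 measureReal_nonneg)]
  calc (μ.real s)⁻¹ * |∫ x in s, f x ∂μ|
      ≤ (μ.real s)⁻¹ * (√(μ.real s) * ‖f‖) := by gcongr
    _ = (√(μ.real s))⁻¹ * ‖f‖ := by
      rw [← mul_assoc, inv_mul_eq_div, Real.sqrt_div_self', one_div]

theorem memLp_indicator_sub_const {p : ENNReal} {f : α → ℝ} (hf : MemLp f p μ)
    {s : Set α} (hs : MeasurableSet s) (hμs : μ s ≠ ⊤) (c : ℝ) :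
    MemLp (s.indicator fun x => f x - c) p μ := by
  rw [show (s.indicator fun x => f x - c) = s.indicator f - s.indicator fun _ => c from
    Set.indicator_sub s f fun _ => c]
  exact (hf.indicator hs).sub (memLp_indicator_const p hs c (Or.inr hμs))

theorem exists_lp_ae_eq_mul_norm_le {p : ENNReal} {f : α → ℝ} (hf : AEStronglyMeasurable f μ)
    {M : ℝ} (hM : ∀ᵐ x ∂μ, |f x| ≤ M) (g : Lp ℝ p μ) :
    ∃ h : Lp ℝ p μ, (h =ᵐ[μ] fun x => f x * g x) ∧ ‖h‖ ≤ M * ‖g‖ := by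
  have hle : ∀ᵐ x ∂μ, ‖f x * g x‖ ≤ M * ‖g x‖ := by
    filter_upwards [hM] with x hx
    rw [norm_mul]
    exact mul_le_mul_of_nonneg_right hx (norm_nonneg _)
  have hmem : MemLp (fun x => f x * g x) p μ :=
    (Lp.memLp g).of_le_mul (hf.mul (Lp.aestronglyMeasurable g)) hle
  refine ⟨hmem.toLp, hmem.coeFn_toLp, Lp.norm_le_mul_norm_of_ae_le_mul ?_⟩
  filter_upwards [hmem.coeFn_toLp, hle] with x hx hlex
  rwa [hx]

end General

namespace DyadicGrid

section Interval

variable {I : Set ℝ}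

theorem isBounded_of_ordConnected (hI : I.OrdConnected) (hv : volume I ≠ ⊤) :
    Bornology.IsBounded I := by
  refine Metric.isBounded_iff.2 ⟨volume.real I, fun x hx y hy => ?_⟩
  have h : volume.real (Set.uIcc x y) ≤ volume.real I :=
    measureReal_mono (hI.uIcc_subset hx hy) hv
  rwa [Measure.real, Real.volume_interval, ENNReal.toReal_ofReal (abs_nonneg _), abs_sub_comm,
    ← Real.dist_eq] at h

theorem ae_eq_Icc_of_ordConnected (hI : I.OrdConnected) (hv : volume I ≠ ⊤) :
    I =ᵐ[volume] Set.Icc (sInf I) (sSup I) := by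
  rcases I.eq_empty_or_nonempty with rfl | hne
  · simpa using (ae_eq_empty.2 (measure_singleton (0 : ℝ))).symm
  have hb := isBounded_of_ordConnected hI hv
  have hIoo : Set.Ioo (sInf I) (sSup I) ⊆ I :=
    IsConnected.Ioo_csInf_csSup_subset ⟨hne, hI.isPreconnected⟩ hb.bddBelow hb.bddAbove
  exact (subset_Icc_csInf_csSup hb.bddBelow hb.bddAbove).eventuallyLE.antisymm
    (Ioo_ae_eq_Icc.symm.le.trans hIoo.eventuallyLE)

theorem volumeReal_of_ordConnected (hI : I.OrdConnected) (hv : volume I ≠ ⊤) :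
    volume.real I = sSup I - sInf I := by
  have hb := isBounded_of_ordConnected hI hv
  rw [measureReal_congr (ae_eq_Icc_of_ordConnected hI hv),
    Real.volume_real_Icc_of_le (Real.sInf_le_sSup I hb.bddBelow hb.bddAbove)]

theorem closedBall_midpt_eq_Icc (hI : I.OrdConnected) (hv : volume I ≠ ⊤) :
    Metric.closedBall (midpt I) (volume.real I / 2) = Set.Icc (sInf I) (sSup I) := by
  rw [Real.closedBall_eq_Icc, volumeReal_of_ordConnected hI hv, midpt]
  congr 1 <;> ring

theorem ae_eq_closedBall_midpt (hI : I.OrdConnected) (hv : volume I ≠ ⊤) :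
    I =ᵐ[volume] Metric.closedBall (midpt I) (volume.real I / 2) :=
  closedBall_midpt_eq_Icc hI hv ▸ ae_eq_Icc_of_ordConnected hI hv

theorem subset_closedBall_midpt (hI : I.OrdConnected) (hv : volume I ≠ ⊤) :
    I ⊆ Metric.closedBall (midpt I) (volume.real I / 2) :=
  have hb := isBounded_of_ordConnected hI hv
  closedBall_midpt_eq_Icc hI hv ▸ subset_Icc_csInf_csSup hb.bddBelow hb.bddAbove

theorem haar_eq_zero_of_notMem {x : ℝ} (hx : x ∉ I) : haar I x = 0 := by
  simp [haar, leftHalf, rightHalf, hx]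

end Interval

/-- `J` is an interval of positive length and `L`, `R` are intervals forming its left and right
halves. Unlike `leftHalf` and `rightHalf`, the sets `L` and `R` cover all of `J`; which of them
contains the midpoint is left open, as it depends on the grid. -/
structure IsBisection (J L R : Set ℝ) : Prop where
  ordConnected_left : L.OrdConnected
  ordConnected_right : R.OrdConnected
  union_eq : L ∪ R = J
  lt : ∀ a ∈ L, ∀ b ∈ R, a < b
  volumeReal_left : volume.real L = volume.real J / 2
  volumeReal_right : volume.real R = volume.real J / 2
  volumeReal_pos : 0 < volume.real J

namespace IsBisection

variable {J L R : Set ℝ} (h : IsBisection J L R)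
include h

theorem left_subset : L ⊆ J :=
  h.union_eq ▸ Set.subset_union_left

theorem right_subset : R ⊆ J :=
  h.union_eq ▸ Set.subset_union_right

theorem disjoint : Disjoint L R :=
  Set.disjoint_left.2 fun x hL hR => lt_irrefl x (h.lt x hL x hR)

theorem volume_ne_top : volume J ≠ ⊤ :=
  (ENNReal.toReal_pos_iff.1 h.volumeReal_pos).2.ne

theorem volumeReal_left_pos : 0 < volume.real L := by
  linarith [h.volumeReal_left, h.volumeReal_pos]

theorem volumeReal_right_pos : 0 < volume.real R := by
  linarith [h.volumeReal_right, h.volumeReal_pos]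

theorem subset_Iic_midpt_and_subset_Ici_midpt :
    L ⊆ Set.Iic (midpt J) ∧ R ⊆ Set.Ici (midpt J) := by
  have hLv : volume L ≠ ⊤ := (ENNReal.toReal_pos_iff.1 h.volumeReal_left_pos).2.ne
  have hRv : volume R ≠ ⊤ := (ENNReal.toReal_pos_iff.1 h.volumeReal_right_pos).2.ne
  have hLne : L.Nonempty := nonempty_of_measureReal_ne_zero h.volumeReal_left_pos.ne'
  have hRne : R.Nonempty := nonempty_of_measureReal_ne_zero h.volumeReal_right_pos.ne'
  have hLb := isBounded_of_ordConnected h.ordConnected_left hLv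
  have hRb := isBounded_of_ordConnected h.ordConnected_right hRv
  have hsep : sSup L ≤ sInf R :=
    csSup_le hLne fun a ha => le_csInf hRne fun b hb => (h.lt a ha b hb).le
  have hL := Real.sInf_le_sSup L hLb.bddBelow hLb.bddAbove
  have hR := Real.sInf_le_sSup R hRb.bddBelow hRb.bddAbove
  have hinf : sInf J = sInf L := by
    rw [← h.union_eq, csInf_union hLb.bddBelow hLne hRb.bddBelow hRne, inf_eq_left]
    exact hL.trans hsep
  have hsup : sSup J = sSup R := by
    rw [← h.union_eq, csSup_union hLb.bddAbove hLne hRb.bddAbove hRne, sup_eq_right]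
    exact hsep.trans hR
  have hlength : sSup L - sInf L = sSup R - sInf R := by
    rw [← volumeReal_of_ordConnected h.ordConnected_left hLv,
      ← volumeReal_of_ordConnected h.ordConnected_right hRv, h.volumeReal_left,
      h.volumeReal_right]
  have hmid : sSup L ≤ midpt J ∧ midpt J ≤ sInf R := by
    rw [midpt, hinf, hsup]
    constructor <;> linarith
  exact ⟨fun a ha => (le_csSup hLb.bddAbove ha).trans hmid.1,
    fun b hb => hmid.2.trans (csInf_le hRb.bddBelow hb)⟩

theorem ae_haar_eq_of_mem_left : ∀ᵐ x, x ∈ L → haar J x = -(√(volume.real J))⁻¹ := by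
  filter_upwards [Measure.ae_ne volume (midpt J)] with x hx hxL
  have hlt : x < midpt J := lt_of_le_of_ne (h.subset_Iic_midpt_and_subset_Ici_midpt.1 hxL) hx
  simp [haar, leftHalf, rightHalf, h.left_subset hxL, hlt, hlt.le]

theorem ae_haar_eq_of_mem_right : ∀ᵐ x, x ∈ R → haar J x = (√(volume.real J))⁻¹ := by
  filter_upwards [Measure.ae_ne volume (midpt J)] with x hx hxR
  have hlt : midpt J < x :=
    lt_of_le_of_ne (h.subset_Iic_midpt_and_subset_Ici_midpt.2 hxR) hx.symm
  simp [haar, leftHalf, rightHalf, h.right_subset hxR, hlt, hlt.le]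

variable {f : ℝ → ℝ}

theorem integral_eq_add (hf : IntegrableOn f J) :
    ∫ x in J, f x = (∫ x in L, f x) + ∫ x in R, f x := by
  rw [← h.union_eq, setIntegral_union h.disjoint h.ordConnected_right.measurableSet
    (hf.mono_set h.left_subset) (hf.mono_set h.right_subset)]

theorem integrable_mul_haar (hf : IntegrableOn f J) : Integrable fun x => f x * haar J x := by
  have hL : IntegrableOn (fun x => f x * haar J x) L := by
    refine IntegrableOn.congr_fun_ae
      ((hf.mono_set h.left_subset).mul_const (-(√(volume.real J))⁻¹)) ?_
    filter_upwards [ae_restrict_of_ae h.ae_haar_eq_of_mem_left,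
      ae_restrict_mem h.ordConnected_left.measurableSet] with x hx hxL
    rw [hx hxL]
  have hR : IntegrableOn (fun x => f x * haar J x) R := by
    refine IntegrableOn.congr_fun_ae
      ((hf.mono_set h.right_subset).mul_const (√(volume.real J))⁻¹) ?_
    filter_upwards [ae_restrict_of_ae h.ae_haar_eq_of_mem_right,
      ae_restrict_mem h.ordConnected_right.measurableSet] with x hx hxR
    rw [hx hxR]
  refine (integrableOn_iff_integrable_of_support_subset fun x hx => ?_).1
    (h.union_eq ▸ hL.union hR : IntegrableOn _ J)
  by_contra hxJ
  exact hx (by simp [haar_eq_zero_of_notMem hxJ])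

theorem integral_mul_haar (hf : IntegrableOn f J) :
    ∫ x, f x * haar J x = (√(volume.real J))⁻¹ * ((∫ x in R, f x) - ∫ x in L, f x) := by
  have hL : ∫ x in L, f x * haar J x = ∫ x in L, f x * -(√(volume.real J))⁻¹ := by
    refine setIntegral_congr_ae h.ordConnected_left.measurableSet ?_
    filter_upwards [h.ae_haar_eq_of_mem_left] with x hx hxL
    rw [hx hxL]
  have hR : ∫ x in R, f x * haar J x = ∫ x in R, f x * (√(volume.real J))⁻¹ := by
    refine setIntegral_congr_ae h.ordConnected_right.measurableSet ?_
    filter_upwards [h.ae_haar_eq_of_mem_right] with x hx hxR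
    rw [hx hxR]
  have hJ : ∫ x in J, f x * haar J x = ∫ x, f x * haar J x :=
    setIntegral_eq_integral_of_forall_compl_eq_zero fun x hx => by
      rw [haar_eq_zero_of_notMem hx, mul_zero]
  rw [← hJ, h.integral_eq_add (h.integrable_mul_haar hf).integrableOn, hL, hR,
    integral_mul_const, integral_mul_const]
  ring

theorem integral_haar : ∫ x, haar J x = 0 := by
  simpa [h.volumeReal_left, h.volumeReal_right] using
    h.integral_mul_haar (f := fun _ => 1) (integrableOn_const h.volume_ne_top)

theorem integral_haar_mul_haar : ∫ x, haar J x * haar J x = 1 := by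
  have hL : ∫ x in L, haar J x = volume.real L * -(√(volume.real J))⁻¹ := by
    rw [setIntegral_congr_ae h.ordConnected_left.measurableSet h.ae_haar_eq_of_mem_left,
      setIntegral_const, smul_eq_mul]
  have hR : ∫ x in R, haar J x = volume.real R * (√(volume.real J))⁻¹ := by
    rw [setIntegral_congr_ae h.ordConnected_right.measurableSet h.ae_haar_eq_of_mem_right,
      setIntegral_const, smul_eq_mul]
  have hint : Integrable (haar J) := by
    simpa using h.integrable_mul_haar (f := fun _ => 1) (integrableOn_const h.volume_ne_top)
  have hsqrt : √(volume.real J) ≠ 0 := (Real.sqrt_pos.2 h.volumeReal_pos).ne'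
  rw [h.integral_mul_haar hint.integrableOn, hL, hR, h.volumeReal_left, h.volumeReal_right]
  field_simp
  rw [Real.sq_sqrt h.volumeReal_pos.le]
  ring

theorem setAverage_right_sub_setAverage (hf : IntegrableOn f J) :
    (⨍ x in R, f x) - ⨍ x in J, f x = (√(volume.real J))⁻¹ * ∫ x, f x * haar J x := by
  have hpos := h.volumeReal_pos
  rw [h.integral_mul_haar hf, ← mul_assoc, ← mul_inv, Real.mul_self_sqrt hpos.le]
  simp only [setAverage_eq, smul_eq_mul, h.volumeReal_right, h.integral_eq_add hf]
  field_simp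
  ring

theorem setAverage_left_sub_setAverage (hf : IntegrableOn f J) :
    (⨍ x in L, f x) - ⨍ x in J, f x = -((√(volume.real J))⁻¹ * ∫ x, f x * haar J x) := by
  have hpos := h.volumeReal_pos
  rw [h.integral_mul_haar hf, ← mul_assoc, ← mul_inv, Real.mul_self_sqrt hpos.le]
  simp only [setAverage_eq, smul_eq_mul, h.volumeReal_left, h.integral_eq_add hf]
  field_simp
  ring

/-- Subtracting a constant is harmless because `h_J` has mean zero, and cutting off outside a
superset of `J` because `h_J` is supported in `J`. -/
theorem integral_indicator_sub_const_mul_haar (hf : IntegrableOn f J) {I : Set ℝ} (hJI : J ⊆ I)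
    (c : ℝ) : ∫ x, I.indicator (fun y => f y - c) x * haar J x = ∫ x, f x * haar J x := by
  calc ∫ x, I.indicator (fun y => f y - c) x * haar J x
      = ∫ x, (f x * haar J x - c * haar J x) := by
        congr 1 with x
        by_cases hx : x ∈ J
        · rw [Set.indicator_of_mem (hJI hx), sub_mul]
        · simp [haar_eq_zero_of_notMem hx]
    _ = ∫ x, f x * haar J x := by
        rw [integral_sub (h.integrable_mul_haar hf)
          (h.integrable_mul_haar (integrableOn_const h.volume_ne_top)), integral_const_mul,
          h.integral_haar, mul_zero, sub_zero]

end IsBisection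

section Grid

variable {D : DyadicGrid}

theorem volume_ne_top (I : D.intervals) : volume (I : Set ℝ) ≠ ⊤ := by
  obtain ⟨k, hk⟩ := D.length_of_mem I I.2
  exact hk ▸ ENNReal.ofReal_ne_top

theorem measurableSet_coe (I : D.intervals) : MeasurableSet (I : Set ℝ) :=
  (D.interval_of_mem I I.2).measurableSet

theorem volume_eq_ofReal_zpow_iff (I : D.intervals) (k : ℤ) :
    volume (I : Set ℝ) = ENNReal.ofReal (2 ^ k) ↔ volume.real (I : Set ℝ) = 2 ^ k := by
  constructor <;> intro h
  · rw [Measure.real, h, ENNReal.toReal_ofReal (by positivity)]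
  · rw [← h, Measure.real, ENNReal.ofReal_toReal (volume_ne_top I)]

theorem exists_volumeReal_eq_zpow (I : D.intervals) :
    ∃ k : ℤ, volume.real (I : Set ℝ) = 2 ^ k :=
  (D.length_of_mem I I.2).imp fun k => (volume_eq_ofReal_zpow_iff I k).1

theorem volumeReal_pos (I : D.intervals) : 0 < volume.real (I : Set ℝ) := by
  obtain ⟨k, hk⟩ := exists_volumeReal_eq_zpow I
  rw [hk]
  positivity

theorem coe_nonempty (I : D.intervals) : (I : Set ℝ).Nonempty :=
  nonempty_of_measureReal_ne_zero (volumeReal_pos I).ne'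

theorem exists_mem_volumeReal_eq (D : DyadicGrid) (k : ℤ) (x : ℝ) :
    ∃ I : D.intervals, x ∈ (I : Set ℝ) ∧ volume.real (I : Set ℝ) = 2 ^ k := by
  obtain ⟨I, ⟨⟨hI, hv⟩, hx⟩, -⟩ := (D.partition k).2 x
  exact ⟨⟨I, hI⟩, hx, (volume_eq_ofReal_zpow_iff ⟨I, hI⟩ k).1 hv⟩

theorem eq_of_volumeReal_eq {I J : D.intervals}
    (h : volume.real (I : Set ℝ) = volume.real (J : Set ℝ)) {x : ℝ} (hxI : x ∈ (I : Set ℝ))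
    (hxJ : x ∈ (J : Set ℝ)) : I = J := by
  obtain ⟨k, hk⟩ := exists_volumeReal_eq_zpow J
  exact Subtype.ext <| ((D.partition k).2 x).unique
    ⟨⟨I.2, (volume_eq_ofReal_zpow_iff I k).2 (h.trans hk)⟩, hxI⟩
    ⟨⟨J.2, (volume_eq_ofReal_zpow_iff J k).2 hk⟩, hxJ⟩

theorem disjoint_of_volumeReal_eq {I J : D.intervals}
    (h : volume.real (I : Set ℝ) = volume.real (J : Set ℝ)) (hne : I ≠ J) :
    Disjoint (I : Set ℝ) J :=
  Set.disjoint_left.2 fun _ hxI hxJ => hne (eq_of_volumeReal_eq h hxI hxJ)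

theorem volumeReal_mono {I J : D.intervals} (h : (I : Set ℝ) ⊆ J) :
    volume.real (I : Set ℝ) ≤ volume.real (J : Set ℝ) :=
  measureReal_mono h (volume_ne_top J)

theorem disjoint_or_subset_or_subset (I J : D.intervals) :
    Disjoint (I : Set ℝ) J ∨ (I : Set ℝ) ⊆ J ∨ (J : Set ℝ) ⊆ I := by
  simpa only [Set.disjoint_iff_inter_eq_empty, Set.inter_eq_left, Set.inter_eq_right] using
    D.nested I I.2 J J.2

theorem subset_of_volumeReal_le {I J : D.intervals}
    (h : volume.real (I : Set ℝ) ≤ volume.real (J : Set ℝ)) {x : ℝ} (hxI : x ∈ (I : Set ℝ))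
    (hxJ : x ∈ (J : Set ℝ)) : (I : Set ℝ) ⊆ J := by
  rcases disjoint_or_subset_or_subset I J with hdisj | hIJ | hJI
  · exact (Set.disjoint_left.1 hdisj hxI hxJ).elim
  · exact hIJ
  · rw [eq_of_volumeReal_eq (h.antisymm (volumeReal_mono hJI)) hxI hxJ]

theorem volumeReal_le_half_of_ssubset {I J : D.intervals} (h : (I : Set ℝ) ⊂ J) :
    volume.real (I : Set ℝ) ≤ volume.real (J : Set ℝ) / 2 := by
  obtain ⟨x, hx⟩ := coe_nonempty I
  have hlt : volume.real (I : Set ℝ) < volume.real (J : Set ℝ) :=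
    lt_of_le_of_ne (volumeReal_mono h.subset)
      fun heq => h.ne (congrArg _ (eq_of_volumeReal_eq heq hx (h.subset hx)))
  obtain ⟨i, hi⟩ := exists_volumeReal_eq_zpow I
  obtain ⟨j, hj⟩ := exists_volumeReal_eq_zpow J
  rw [hi, hj] at hlt ⊢
  have hij : i ≤ j - 1 := Int.le_sub_one_of_lt ((zpow_lt_zpow_iff_right₀ one_lt_two).1 hlt)
  calc (2 : ℝ) ^ i ≤ 2 ^ (j - 1) := zpow_le_zpow_right₀ one_le_two hij
    _ = 2 ^ j / 2 := zpow_sub_one₀ two_ne_zero j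

theorem exists_half_mem {J : D.intervals} {x : ℝ} (hx : x ∈ (J : Set ℝ)) :
    ∃ K : D.intervals, x ∈ (K : Set ℝ) ∧ volume.real (K : Set ℝ) = volume.real (J : Set ℝ) / 2 ∧
      (K : Set ℝ) ⊆ J := by
  obtain ⟨k, hk⟩ := exists_volumeReal_eq_zpow J
  obtain ⟨K, hxK, hK⟩ := D.exists_mem_volumeReal_eq (k - 1) x
  have hhalf : volume.real (K : Set ℝ) = volume.real (J : Set ℝ) / 2 := by
    rw [hK, hk, zpow_sub_one₀ two_ne_zero, div_eq_mul_inv]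
  exact ⟨K, hxK, hhalf, subset_of_volumeReal_le (by linarith [volumeReal_pos J]) hxK hx⟩

theorem exists_disjoint_halves (J : D.intervals) :
    ∃ A B : D.intervals, volume.real (A : Set ℝ) = volume.real (J : Set ℝ) / 2 ∧
      volume.real (B : Set ℝ) = volume.real (J : Set ℝ) / 2 ∧ Disjoint (A : Set ℝ) B ∧
      (A ∪ B : Set ℝ) = J := by
  have hJ := volumeReal_pos J
  obtain ⟨x, hx⟩ := coe_nonempty J
  obtain ⟨A, -, hA, hAJ⟩ := exists_half_mem hx
  obtain ⟨y, hyJ, hyA⟩ : ∃ y ∈ (J : Set ℝ), y ∉ (A : Set ℝ) := by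
    by_contra! hJA
    linarith [volumeReal_mono (I := J) (J := A) hJA]
  obtain ⟨B, hyB, hB, hBJ⟩ := exists_half_mem hyJ
  have hAB : Disjoint (A : Set ℝ) B :=
    disjoint_of_volumeReal_eq (hA.trans hB.symm) fun h => hyA (h ▸ hyB)
  refine ⟨A, B, hA, hB, hAB, (Set.union_subset hAJ hBJ).antisymm fun z hz => ?_⟩
  by_contra hzAB
  obtain ⟨hzA, hzB⟩ := not_or.1 hzAB
  -- A third half of `J` would exceed the length of `J`.
  obtain ⟨C, hzC, hC, hCJ⟩ := exists_half_mem hz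
  have hAC : Disjoint (A : Set ℝ) C :=
    disjoint_of_volumeReal_eq (hA.trans hC.symm) fun h => hzA (h ▸ hzC)
  have hBC : Disjoint (B : Set ℝ) C :=
    disjoint_of_volumeReal_eq (hB.trans hC.symm) fun h => hzB (h ▸ hzC)
  have hsum : volume.real (A ∪ B ∪ C : Set ℝ) =
      volume.real (A : Set ℝ) + volume.real (B : Set ℝ) + volume.real (C : Set ℝ) := by
    rw [measureReal_union (hAC.union_left hBC) (measurableSet_coe C)
        (measure_union_ne_top (volume_ne_top A) (volume_ne_top B)) (volume_ne_top C),
      measureReal_union hAB (measurableSet_coe B) (volume_ne_top A) (volume_ne_top B)]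
  have hle : volume.real (A ∪ B ∪ C : Set ℝ) ≤ volume.real (J : Set ℝ) :=
    measureReal_mono (Set.union_subset (Set.union_subset hAJ hBJ) hCJ) (volume_ne_top J)
  linarith

theorem exists_isBisection (J : D.intervals) : ∃ L R : D.intervals, IsBisection J L R := by
  obtain ⟨A, B, hA, hB, hAB, hunion⟩ := exists_disjoint_halves J
  have hAo := D.interval_of_mem A A.2
  have hBo := D.interval_of_mem B B.2
  obtain ⟨a, ha⟩ := coe_nonempty A
  obtain ⟨b, hb⟩ := coe_nonempty B
  rcases lt_or_gt_of_ne (hAB.ne_of_mem ha hb) with hab | hba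
  · exact ⟨A, B, hAo, hBo, hunion, lt_of_disjoint_of_ordConnected hAo hBo hAB ha hb hab, hA, hB,
      volumeReal_pos J⟩
  · exact ⟨B, A, hBo, hAo, Set.union_comm (A : Set ℝ) B ▸ hunion,
      lt_of_disjoint_of_ordConnected hBo hAo hAB.symm hb ha hba, hB, hA, volumeReal_pos J⟩

theorem IsBisection.subset_or_subset {I J L R : D.intervals} (h : IsBisection (J : Set ℝ) L R)
    (hIJ : (I : Set ℝ) ⊂ J) : (I : Set ℝ) ⊆ L ∨ (I : Set ℝ) ⊆ R := by
  obtain ⟨x, hx⟩ := coe_nonempty I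
  have hI := volumeReal_le_half_of_ssubset hIJ
  have hxJ : x ∈ (L ∪ R : Set ℝ) := h.union_eq ▸ hIJ.subset hx
  exact hxJ.imp (subset_of_volumeReal_le (hI.trans h.volumeReal_left.ge) hx)
    (subset_of_volumeReal_le (hI.trans h.volumeReal_right.ge) hx)

/-- The interval of length `2 ^ k` of the grid that contains `x`. -/
noncomputable def cell (D : DyadicGrid) (k : ℤ) (x : ℝ) : D.intervals :=
  (D.exists_mem_volumeReal_eq k x).choose

theorem mem_cell (D : DyadicGrid) (k : ℤ) (x : ℝ) : x ∈ (D.cell k x : Set ℝ) :=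
  (D.exists_mem_volumeReal_eq k x).choose_spec.1

theorem volumeReal_cell (D : DyadicGrid) (k : ℤ) (x : ℝ) :
    volume.real (D.cell k x : Set ℝ) = 2 ^ k :=
  (D.exists_mem_volumeReal_eq k x).choose_spec.2

theorem cell_eq {I : D.intervals} {k : ℤ} {x : ℝ} (hx : x ∈ (I : Set ℝ))
    (hI : volume.real (I : Set ℝ) = 2 ^ k) : D.cell k x = I :=
  eq_of_volumeReal_eq ((D.volumeReal_cell k x).trans hI.symm) (D.mem_cell k x) hx

open Classical in
/-- The intervals containing `J` form the chain of its ancestors, of lengths `2 ^ n |J|`. -/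
theorem hasSum_ite_subset_iff {E : Type*} [AddCommMonoid E] [TopologicalSpace E] (φ : ℝ → E)
    (J : D.intervals) {a : E} :
    HasSum (fun I : D.intervals => if (J : Set ℝ) ⊆ I then φ (volume.real (I : Set ℝ)) else 0) a ↔
      HasSum (fun n : ℕ => φ (2 ^ n * volume.real (J : Set ℝ))) a := by
  obtain ⟨k, hk⟩ := exists_volumeReal_eq_zpow J
  obtain ⟨x, hx⟩ := coe_nonempty J
  let ancestor : ℕ → D.intervals := fun n => D.cell (k + n) x
  have hvol : ∀ n, volume.real (ancestor n : Set ℝ) = 2 ^ n * volume.real (J : Set ℝ) := by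
    intro n
    rw [D.volumeReal_cell, hk, zpow_add₀ two_ne_zero, zpow_natCast, mul_comm]
  have hsub : ∀ n, (J : Set ℝ) ⊆ ancestor n := fun n =>
    subset_of_volumeReal_le
      (hvol n ▸ le_mul_of_one_le_left measureReal_nonneg (one_le_pow₀ one_le_two))
      hx (D.mem_cell _ x)
  have hinj : Function.Injective ancestor := by
    intro m n hmn
    have h := (hvol m).symm.trans (hmn ▸ hvol n)
    exact pow_right_injective₀ two_pos (by norm_num)
      (mul_right_cancel₀ (volumeReal_pos J).ne' h)
  have hrange : ∀ I : D.intervals, (J : Set ℝ) ⊆ I → I ∈ Set.range ancestor := by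
    intro I hJI
    obtain ⟨i, hi⟩ := exists_volumeReal_eq_zpow I
    have hki : (2 : ℝ) ^ k ≤ 2 ^ i := hk ▸ hi ▸ volumeReal_mono hJI
    obtain ⟨n, rfl⟩ := Int.le.dest ((zpow_le_zpow_iff_right₀ one_lt_two).1 hki)
    exact ⟨n, cell_eq (hJI hx) hi⟩
  rw [← hinj.hasSum_iff fun I hI => if_neg (mt (hrange I) hI)]
  simp only [Function.comp_def, hsub, if_true, hvol]

end Grid

section HaarSystem

variable {D : DyadicGrid}

theorem integrableOn_coe (f : Lp ℝ 2 (volume : Measure ℝ)) (I : D.intervals) :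
    IntegrableOn f I :=
  integrableOn_Lp_of_measure_ne_top f (by norm_num) (volume_ne_top I)

theorem exists_ae_haar_eq_of_ssubset {I J : D.intervals} (h : (I : Set ℝ) ⊂ J) :
    ∃ c : ℝ, ∀ᵐ x, x ∈ (I : Set ℝ) → haar J x = c := by
  obtain ⟨L, R, hJ⟩ := exists_isBisection J
  rcases hJ.subset_or_subset h with hL | hR
  · exact ⟨_, hJ.ae_haar_eq_of_mem_left.mono fun x hx hxI => hx (hL hxI)⟩
  · exact ⟨_, hJ.ae_haar_eq_of_mem_right.mono fun x hx hxI => hx (hR hxI)⟩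

theorem integral_mul_haar_eq_zero_of_ssubset {I J : D.intervals} (h : (I : Set ℝ) ⊂ J)
    {f : ℝ → ℝ} (hf : ∀ x ∉ (I : Set ℝ), f x = 0) (hf0 : ∫ x, f x = 0) :
    ∫ x, f x * haar J x = 0 := by
  obtain ⟨c, hc⟩ := exists_ae_haar_eq_of_ssubset h
  have hfc : ∀ᵐ x, f x * haar J x = f x * c := by
    filter_upwards [hc] with x hx
    by_cases hxI : x ∈ (I : Set ℝ)
    · rw [hx hxI]
    · rw [hf x hxI, zero_mul, zero_mul]
  rw [integral_congr_ae hfc, integral_mul_const, hf0, zero_mul]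

theorem haarLp_coeFn (I : D.intervals) : D.haarLp I =ᵐ[volume] haar I :=
  (D.memLp_haar I).coeFn_toLp

theorem inner_haarLp (I J : D.intervals) :
    inner ℝ (D.haarLp I) (D.haarLp J) = ∫ x, haar I x * haar J x := by
  rw [← haarCoeff_eq_inner, haarCoeff]
  refine integral_congr_ae ?_
  filter_upwards [haarLp_coeFn J] with x hx
  rw [hx, mul_comm]

theorem orthonormal_haarLp (D : DyadicGrid) : Orthonormal ℝ D.haarLp := by
  rw [orthonormal_iff_ite]
  intro I J
  rw [inner_haarLp]
  split_ifs with hIJ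
  · obtain ⟨L, R, h⟩ := exists_isBisection I
    rw [← hIJ, h.integral_haar_mul_haar]
  · have hne : (I : Set ℝ) ≠ J := fun h => hIJ (Subtype.ext h)
    have orthogonal_of_ssubset {I J : D.intervals} (h : (I : Set ℝ) ⊂ J) :
        ∫ x, haar I x * haar J x = 0 := by
      obtain ⟨L, R, hI⟩ := exists_isBisection I
      exact integral_mul_haar_eq_zero_of_ssubset h (fun x hx => haar_eq_zero_of_notMem hx)
        hI.integral_haar
    rcases disjoint_or_subset_or_subset I J with hdisj | h | h
    · refine integral_eq_zero_of_ae (Eventually.of_forall fun x => ?_)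
      by_cases hx : x ∈ (I : Set ℝ)
      · simp [haar_eq_zero_of_notMem (Set.disjoint_left.1 hdisj hx)]
      · simp [haar_eq_zero_of_notMem hx]
    · exact orthogonal_of_ssubset (h.ssubset_of_ne hne)
    · simpa only [mul_comm] using orthogonal_of_ssubset (h.ssubset_of_ne hne.symm)

end HaarSystem

section Averages

variable {D : DyadicGrid}

theorem abs_setAverage_cell_sub (D : DyadicGrid) (f : Lp ℝ 2 (volume : Measure ℝ)) (k : ℤ)
    (x : ℝ) :
    |(⨍ y in D.cell (k - 1) x, f y) - ⨍ y in D.cell k x, f y| =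
      (√(2 ^ k))⁻¹ * |haarCoeff f (D.cell k x)| := by
  obtain ⟨L, R, h⟩ := exists_isBisection (D.cell k x)
  have hf := integrableOn_coe f (D.cell k x)
  have hhalf : volume.real (D.cell k x : Set ℝ) / 2 = 2 ^ (k - 1) := by
    rw [D.volumeReal_cell, zpow_sub_one₀ two_ne_zero, div_eq_mul_inv]
  have hx : x ∈ (L ∪ R : Set ℝ) := h.union_eq ▸ D.mem_cell k x
  rcases hx with hx | hx
  · rw [cell_eq hx (h.volumeReal_left.trans hhalf), h.setAverage_left_sub_setAverage hf, abs_neg,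
      abs_mul, abs_of_nonneg (by positivity), D.volumeReal_cell, haarCoeff]
  · rw [cell_eq hx (h.volumeReal_right.trans hhalf), h.setAverage_right_sub_setAverage hf,
      abs_mul, abs_of_nonneg (by positivity), D.volumeReal_cell, haarCoeff]

theorem ae_tendsto_setAverage_cell (D : DyadicGrid) {E : Type*} [NormedAddCommGroup E]
    [NormedSpace ℝ E] [CompleteSpace E] {f : ℝ → E} (hf : LocallyIntegrable f) :
    ∀ᵐ x, Tendsto (fun n : ℕ => ⨍ y in D.cell (-n) x, f y) atTop (𝓝 (f x)) := by
  filter_upwards [IsUnifLocDoublingMeasure.ae_tendsto_average (μ := volume) hf 1] with x hx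
  have hradius : Tendsto (fun n : ℕ => volume.real (D.cell (-n) x : Set ℝ) / 2) atTop
      (𝓝[>] 0) := by
    refine tendsto_nhdsWithin_iff.2
      ⟨?_, Eventually.of_forall fun n => half_pos (volumeReal_pos (D.cell (-n) x))⟩
    simp only [D.volumeReal_cell, zpow_neg, zpow_natCast, ← inv_pow]
    simpa using (tendsto_pow_atTop_nhds_zero_of_lt_one (by norm_num)
      (by norm_num : (2⁻¹ : ℝ) < 1)).div_const 2
  refine (hx (fun n : ℕ => midpt (D.cell (-n) x)) _ hradius
    (Eventually.of_forall fun n => ?_)).congr fun n => ?_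
  · rw [one_mul]
    exact subset_closedBall_midpt (D.interval_of_mem _ (D.cell (-n) x).2)
      (volume_ne_top (D.cell (-n) x)) (D.mem_cell (-n) x)
  · exact (setAverage_congr (ae_eq_closedBall_midpt
      (D.interval_of_mem _ (D.cell (-n) x).2) (volume_ne_top (D.cell (-n) x)))).symm

end Averages

section Completeness

variable {D : DyadicGrid}

theorem eq_zero_of_haarCoeff_eq_zero {f : Lp ℝ 2 (volume : Measure ℝ)}
    (hf : ∀ I : D.intervals, haarCoeff f I = 0) : f = 0 := by
  have setAverage_cell_eq_zero (x : ℝ) (k : ℤ) : ⨍ y in D.cell k x, f y = 0 := by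
    have hper : Function.Periodic (fun k : ℤ => ⨍ y in D.cell k x, f y) 1 := fun k => by
      have h := D.abs_setAverage_cell_sub f (k + 1) x
      rw [hf, abs_zero, mul_zero, abs_eq_zero, sub_eq_zero, add_sub_cancel_right] at h
      exact h.symm
    have hconst : ∀ n : ℕ, ⨍ y in D.cell n x, f y = ⨍ y in D.cell k x, f y := fun n => by
      simpa using (hper.int_mul_eq n).trans (hper.int_mul_eq k).symm
    have hzero : Tendsto (fun n : ℕ => ⨍ y in D.cell n x, f y) atTop (𝓝 0) := by
      refine squeeze_zero_norm (a := fun n : ℕ => (√(2 ^ n))⁻¹ * ‖f‖) (fun n => ?_) ?_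
      · simpa [D.volumeReal_cell] using
          abs_setAverage_le_norm f (measurableSet_coe (D.cell n x)) (volume_ne_top (D.cell n x))
      · have hsqrt : Tendsto (fun n : ℕ => √((2 : ℝ) ^ n)) atTop atTop :=
          Real.tendsto_sqrt_atTop.comp (tendsto_pow_atTop_atTop_of_one_lt one_lt_two)
        simpa using hsqrt.inv_tendsto_atTop.mul_const ‖f‖
    simp only [hconst] at hzero
    exact tendsto_nhds_unique tendsto_const_nhds hzero
  have hloc : LocallyIntegrable f := (Lp.memLp f).locallyIntegrable (by norm_num)
  refine (Lp.eq_zero_iff_ae_eq_zero).2 ?_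
  filter_upwards [D.ae_tendsto_setAverage_cell hloc] with x hx
  simp only [setAverage_cell_eq_zero] at hx
  exact tendsto_nhds_unique hx tendsto_const_nhds

/-- The Haar functions of a dyadic grid, as a Hilbert basis of `L²(ℝ)`. -/
noncomputable def haarBasis (D : DyadicGrid) :
    HilbertBasis D.intervals ℝ (Lp ℝ 2 (volume : Measure ℝ)) :=
  HilbertBasis.mkOfOrthogonalEqBot D.orthonormal_haarLp <| by
    refine (Submodule.eq_bot_iff _).2 fun f hf => eq_zero_of_haarCoeff_eq_zero (D := D) fun I => ?_
    rw [haarCoeff_eq_inner]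
    exact (Submodule.mem_orthogonal _ f).1 hf _ (Submodule.subset_span ⟨I, rfl⟩)

theorem coe_haarBasis (D : DyadicGrid) : ⇑D.haarBasis = D.haarLp :=
  HilbertBasis.coe_mkOfOrthogonalEqBot _ _

theorem hasSum_haarCoeff_sq (D : DyadicGrid) (f : Lp ℝ 2 (volume : Measure ℝ)) :
    HasSum (fun I : D.intervals => haarCoeff f I ^ 2) (‖f‖ ^ 2) := by
  rw [← real_inner_self_eq_norm_sq]
  refine (D.haarBasis.hasSum_inner_mul_inner f f).congr_fun fun I => ?_
  rw [coe_haarBasis, haarCoeff_eq_inner, real_inner_comm, sq]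

end Completeness

section Sobolev

variable {D : DyadicGrid} {s : ℝ} {f : Lp ℝ 2 (volume : Measure ℝ)}

theorem mem_sobolev_iff_summable_sq :
    f ∈ D.sobolev s ↔
      Summable fun I : D.intervals => (volume.real (I : Set ℝ) ^ (-s) * haarCoeff f I) ^ 2 := by
  change Summable (D.fracDerivTerm s f) ↔ _
  have h := D.orthonormal_haarLp.orthogonalFamily.summable_iff_norm_sq_summable
    fun I => volume.real (I : Set ℝ) ^ (-s) * haarCoeff f I
  simp only [Real.norm_eq_abs, sq_abs] at h
  exact h

theorem haarCoeff_fracDeriv (hf : f ∈ D.sobolev s) (I : D.intervals) :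
    haarCoeff (D.fracDeriv s f) I = volume.real (I : Set ℝ) ^ (-s) * haarCoeff f I := by
  have hsum : HasSum (D.fracDerivTerm s f) (D.fracDeriv s f) := Summable.hasSum hf
  have hinner := hsum.mapL (innerSL ℝ (D.haarLp I))
  simp only [innerSL_apply_apply, fracDerivTerm, inner_smul_right,
    orthonormal_iff_ite.1 D.orthonormal_haarLp, mul_ite, mul_one, mul_zero] at hinner
  rw [haarCoeff_eq_inner, hinner.unique (hasSum_single I fun J hJ => if_neg hJ.symm), if_pos rfl]

theorem hasSum_norm_fracDeriv_sq (hf : f ∈ D.sobolev s) :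
    HasSum (fun I : D.intervals => (volume.real (I : Set ℝ) ^ (-s) * haarCoeff f I) ^ 2)
      (‖D.fracDeriv s f‖ ^ 2) := by
  simpa only [haarCoeff_fracDeriv hf] using D.hasSum_haarCoeff_sq (D.fracDeriv s f)

theorem abs_haarCoeff_le (hf : f ∈ D.sobolev s) (I : D.intervals) :
    |haarCoeff f I| ≤ volume.real (I : Set ℝ) ^ s * ‖D.fracDeriv s f‖ := by
  have hpos := volumeReal_pos I
  have h : (volume.real (I : Set ℝ) ^ (-s) * haarCoeff f I) ^ 2 ≤ ‖D.fracDeriv s f‖ ^ 2 :=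
    le_hasSum (hasSum_norm_fracDeriv_sq hf) I fun J _ => sq_nonneg _
  have habs := abs_le_of_sq_le_sq h (norm_nonneg _)
  rwa [abs_mul, abs_of_pos (Real.rpow_pos_of_pos hpos _), Real.rpow_neg hpos.le,
    inv_mul_le_iff₀ (Real.rpow_pos_of_pos hpos _)] at habs

theorem norm_le_sobolevNorm (D : DyadicGrid) (s : ℝ) (f : Lp ℝ 2 (volume : Measure ℝ)) :
    ‖f‖ ≤ D.sobolevNorm s f :=
  Real.le_sqrt_of_sq_le (le_add_of_nonneg_left (sq_nonneg _))

theorem norm_fracDeriv_le_sobolevNorm (D : DyadicGrid) (s : ℝ)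
    (f : Lp ℝ 2 (volume : Measure ℝ)) : ‖D.fracDeriv s f‖ ≤ D.sobolevNorm s f :=
  Real.le_sqrt_of_sq_le (le_add_of_nonneg_right (sq_nonneg _))

end Sobolev

section Embedding

variable {D : DyadicGrid} {s : ℝ} {f : Lp ℝ 2 (volume : Measure ℝ)}

theorem dist_setAverage_cell_succ_le (hf : f ∈ D.sobolev s) (x : ℝ) (n : ℕ) :
    dist (⨍ y in D.cell (-n) x, f y) (⨍ y in D.cell (-(n + 1 : ℕ)) x, f y) ≤
      ‖D.fracDeriv s f‖ * ((2 : ℝ) ^ (1 / 2 - s)) ^ n := by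
  have hrpow : (√(2 ^ (-n : ℤ)))⁻¹ * ((2 : ℝ) ^ (-n : ℤ)) ^ s = (2 ^ (1 / 2 - s)) ^ n := by
    simp only [← Real.rpow_intCast, ← Real.rpow_natCast, Real.sqrt_eq_rpow,
      ← Real.rpow_mul zero_le_two, ← Real.rpow_neg zero_le_two, ← Real.rpow_add two_pos]
    congr 1
    push_cast
    ring
  have hsucc : (-(n + 1 : ℕ) : ℤ) = -n - 1 := by
    push_cast
    ring
  rw [dist_comm, Real.dist_eq, hsucc, D.abs_setAverage_cell_sub]
  calc (√(2 ^ (-n : ℤ)))⁻¹ * |haarCoeff f (D.cell (-n) x)|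
      ≤ (√(2 ^ (-n : ℤ)))⁻¹ * (((2 : ℝ) ^ (-n : ℤ)) ^ s * ‖D.fracDeriv s f‖) := by
        gcongr
        simpa only [D.volumeReal_cell] using abs_haarCoeff_le hf (D.cell (-n) x)
    _ = ‖D.fracDeriv s f‖ * (2 ^ (1 / 2 - s)) ^ n := by
        rw [← mul_assoc, hrpow, mul_comm]

theorem ae_abs_le_add_mul_norm_fracDeriv (hs : 1 / 2 < s) (hf : f ∈ D.sobolev s) :
    ∀ᵐ x, |f x| ≤ ‖f‖ + ‖D.fracDeriv s f‖ / (1 - 2 ^ (1 / 2 - s)) := by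
  have hloc : LocallyIntegrable f := (Lp.memLp f).locallyIntegrable (by norm_num)
  filter_upwards [D.ae_tendsto_setAverage_cell hloc] with x hx
  have hunit : |⨍ y in D.cell 0 x, f y| ≤ ‖f‖ := by
    simpa [D.volumeReal_cell] using
      abs_setAverage_le_norm f (measurableSet_coe (D.cell 0 x)) (volume_ne_top (D.cell 0 x))
  have hdist : |f x - ⨍ y in D.cell 0 x, f y| ≤ ‖D.fracDeriv s f‖ / (1 - 2 ^ (1 / 2 - s)) := by
    simpa [abs_sub_comm, Real.dist_eq] using dist_le_of_le_geometric_of_tendsto₀ _ _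
      (Real.rpow_lt_one_of_one_lt_of_neg one_lt_two (sub_neg.2 hs))
      (dist_setAverage_cell_succ_le hf x) hx
  calc |f x| = |(⨍ y in D.cell 0 x, f y) + (f x - ⨍ y in D.cell 0 x, f y)| := by
        rw [add_sub_cancel]
    _ ≤ ‖f‖ + ‖D.fracDeriv s f‖ / (1 - 2 ^ (1 / 2 - s)) :=
        (abs_add_le _ _).trans (add_le_add hunit hdist)

/-- The norm of the embedding of `H^s` into `L^∞` is at most this constant. -/
noncomputable def supConst (s : ℝ) : ℝ := 1 + (1 - 2 ^ (1 / 2 - s))⁻¹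

theorem one_le_supConst (hs : 1 / 2 < s) : 1 ≤ supConst s := by
  have h := Real.rpow_lt_one_of_one_lt_of_neg one_lt_two (sub_neg.2 hs)
  exact le_add_of_nonneg_right (inv_nonneg.2 (sub_nonneg.2 h.le))

theorem ae_abs_le_supConst_mul_sobolevNorm (hs : 1 / 2 < s) (hf : f ∈ D.sobolev s) :
    ∀ᵐ x, |f x| ≤ supConst s * D.sobolevNorm s f := by
  have h := Real.rpow_lt_one_of_one_lt_of_neg one_lt_two (sub_neg.2 hs)
  filter_upwards [ae_abs_le_add_mul_norm_fracDeriv hs hf] with x hx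
  calc |f x| ≤ ‖f‖ + ‖D.fracDeriv s f‖ / (1 - 2 ^ (1 / 2 - s)) := hx
    _ ≤ D.sobolevNorm s f + D.sobolevNorm s f / (1 - 2 ^ (1 / 2 - s)) := by
        gcongr
        · exact D.norm_le_sobolevNorm s f
        · exact D.norm_fracDeriv_le_sobolevNorm s f
    _ = supConst s * D.sobolevNorm s f := by
        rw [supConst, add_mul, one_mul, div_eq_inv_mul]

end Embedding

section MeanOscillation

variable {D : DyadicGrid} {s : ℝ}

/-- The function `(f - ⨍_I f) 1_I`, as an element of `L²(ℝ)`; its norm is the (unnormalized)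
quadratic mean oscillation of `f` on `I`. -/
noncomputable def meanOscillation (f : Lp ℝ 2 (volume : Measure ℝ)) (I : D.intervals) :
    Lp ℝ 2 (volume : Measure ℝ) :=
  (memLp_indicator_sub_const (Lp.memLp f) (measurableSet_coe I) (volume_ne_top I)
    (⨍ y in I, f y)).toLp

theorem meanOscillation_coeFn (f : Lp ℝ 2 (volume : Measure ℝ)) (I : D.intervals) :
    meanOscillation f I =ᵐ[volume] (I : Set ℝ).indicator fun x => f x - ⨍ y in I, f y :=
  MemLp.coeFn_toLp _

open Classical in
theorem haarCoeff_meanOscillation (f : Lp ℝ 2 (volume : Measure ℝ)) (I J : D.intervals) :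
    haarCoeff (meanOscillation f I) J = if (J : Set ℝ) ⊆ I then haarCoeff f J else 0 := by
  have hcoeff : haarCoeff (meanOscillation f I) J =
      ∫ x, (I : Set ℝ).indicator (fun y => f y - ⨍ z in I, f z) x * haar J x := by
    refine integral_congr_ae ?_
    filter_upwards [meanOscillation_coeFn f I] with x hx
    rw [hx]
  rw [hcoeff]
  split_ifs with hJI
  · obtain ⟨L, R, h⟩ := exists_isBisection J
    exact h.integral_indicator_sub_const_mul_haar (integrableOn_coe f J) hJI _
  rcases disjoint_or_subset_or_subset I J with hdisj | hIJ | hJI'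
  · refine integral_eq_zero_of_ae (Eventually.of_forall fun x => ?_)
    by_cases hx : x ∈ (I : Set ℝ)
    · simp [haar_eq_zero_of_notMem (Set.disjoint_left.1 hdisj hx)]
    · simp [hx]
  · refine integral_mul_haar_eq_zero_of_ssubset ⟨hIJ, hJI⟩
      (fun x hx => Set.indicator_of_notMem hx _) ?_
    rw [integral_indicator (measurableSet_coe I)]
    have : IsFiniteMeasure (volume.restrict (I : Set ℝ)) :=
      isFiniteMeasure_restrict.2 (volume_ne_top I)
    exact integral_sub_average _ _
  · exact (hJI hJI').elim

open Classical in
theorem hasSum_norm_meanOscillation_sq (f : Lp ℝ 2 (volume : Measure ℝ)) (I : D.intervals) :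
    HasSum (fun J : D.intervals => if (J : Set ℝ) ⊆ I then haarCoeff f J ^ 2 else 0)
      (‖meanOscillation f I‖ ^ 2) := by
  refine (D.hasSum_haarCoeff_sq (meanOscillation f I)).congr_fun fun J => ?_
  simp only [haarCoeff_meanOscillation, ite_pow, ne_eq, OfNat.ofNat_ne_zero, not_false_eq_true,
    zero_pow]

theorem hasSum_weighted_norm_meanOscillation_sq (hs : 0 < s)
    {f : Lp ℝ 2 (volume : Measure ℝ)} (hf : f ∈ D.sobolev s) :
    HasSum (fun I : D.intervals => (volume.real (I : Set ℝ) ^ (-s) * ‖meanOscillation f I‖) ^ 2)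
      ((1 - (2 : ℝ) ^ (-2 * s))⁻¹ * ‖D.fracDeriv s f‖ ^ 2) := by
  classical
  refine hasSum_comm_of_nonneg
    (f := fun J I : D.intervals => if (J : Set ℝ) ⊆ I
      then (volume.real (I : Set ℝ) ^ (-s)) ^ 2 * haarCoeff f J ^ 2 else 0)
    (fun J I => by positivity) (fun J => ?_) (fun I => ?_)
    ((hasSum_norm_fracDeriv_sq hf).mul_left _)
  · rw [hasSum_ite_subset_iff (fun v => (v ^ (-s)) ^ 2 * haarCoeff f J ^ 2), mul_pow, ← mul_assoc]
    exact (hasSum_rpow_two_pow_mul_sq hs measureReal_nonneg).mul_right _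
  · rw [mul_pow]
    simpa only [mul_ite, mul_zero] using (hasSum_norm_meanOscillation_sq f I).mul_left _

end MeanOscillation

section Product

variable {D : DyadicGrid} {s : ℝ}

theorem abs_haarCoeff_le_norm_of_ae_abs_sub_le {g u : Lp ℝ 2 (volume : Measure ℝ)}
    {I : D.intervals} {a : ℝ} (h : ∀ᵐ x, x ∈ (I : Set ℝ) → |g x - a| ≤ |u x|) :
    |haarCoeff g I| ≤ ‖u‖ := by
  have hmem := memLp_indicator_sub_const (Lp.memLp g) (measurableSet_coe I) (volume_ne_top I) a
  let v : Lp ℝ 2 (volume : Measure ℝ) := hmem.toLp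
  have hcoeff : haarCoeff g I = haarCoeff v I := by
    obtain ⟨L, R, hI⟩ := exists_isBisection I
    rw [haarCoeff, ← hI.integral_indicator_sub_const_mul_haar (integrableOn_coe g I) subset_rfl a]
    refine integral_congr_ae ?_
    filter_upwards [hmem.coeFn_toLp] with x hx
    rw [hx]
  have hvu : ‖v‖ ≤ ‖u‖ := by
    refine Lp.norm_le_norm_of_ae_le ?_
    filter_upwards [hmem.coeFn_toLp, h] with x hvx hx
    rw [hvx]
    by_cases hxI : x ∈ (I : Set ℝ)
    · simpa [hxI] using hx hxI
    · simp [hxI]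
  calc |haarCoeff g I| = |inner ℝ (D.haarLp I) v| := by rw [hcoeff, haarCoeff_eq_inner]
    _ ≤ ‖D.haarLp I‖ * ‖v‖ := abs_real_inner_le_norm _ _
    _ ≤ ‖u‖ := by rwa [D.orthonormal_haarLp.1, one_mul]

theorem abs_setAverage_le_of_ae_abs_le {f : ℝ → ℝ} {M : ℝ} (hf : ∀ᵐ x, |f x| ≤ M)
    (I : D.intervals) : |⨍ x in I, f x| ≤ M := by
  simp only [← Real.norm_eq_abs] at hf ⊢
  have : IsFiniteMeasure (volume.restrict (I : Set ℝ)) :=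
    isFiniteMeasure_restrict.2 (volume_ne_top I)
  have : NeZero (volume.restrict (I : Set ℝ)) :=
    ⟨fun h => (volumeReal_pos I).ne' (by simp [Measure.real, Measure.restrict_eq_zero.1 h])⟩
  exact norm_average_le_of_norm_le_ae (ae_restrict_of_ae hf)

variable {f₁ f₂ g : Lp ℝ 2 (volume : Measure ℝ)} {M₁ M₂ : ℝ}

theorem abs_haarCoeff_le_of_ae_eq_mul (hg : g =ᵐ[volume] fun x => f₁ x * f₂ x)
    (h₁ : ∀ᵐ x, |f₁ x| ≤ M₁) (h₂ : ∀ᵐ x, |f₂ x| ≤ M₂) (I : D.intervals) :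
    |haarCoeff g I| ≤ M₁ * ‖meanOscillation f₂ I‖ + M₂ * ‖meanOscillation f₁ I‖ := by
  have ha₂ := abs_setAverage_le_of_ae_abs_le h₂ I
  have hM₂ : 0 ≤ M₂ := (abs_nonneg _).trans ha₂
  have hM₁ : 0 ≤ M₁ := (abs_nonneg _).trans (abs_setAverage_le_of_ae_abs_le h₁ I)
  set a₁ := ⨍ x in I, f₁ x
  set a₂ := ⨍ x in I, f₂ x
  let u := M₁ • |meanOscillation f₂ I| + M₂ • |meanOscillation f₁ I|
  have hu : ∀ᵐ x, x ∈ (I : Set ℝ) → u x = M₁ * |f₂ x - a₂| + M₂ * |f₁ x - a₁| := by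
    filter_upwards [Lp.coeFn_add (M₁ • |meanOscillation f₂ I|) (M₂ • |meanOscillation f₁ I|),
      Lp.coeFn_smul M₁ |meanOscillation f₂ I|, Lp.coeFn_smul M₂ |meanOscillation f₁ I|,
      Lp.coeFn_abs (meanOscillation f₂ I), Lp.coeFn_abs (meanOscillation f₁ I),
      meanOscillation_coeFn f₂ I, meanOscillation_coeFn f₁ I]
      with x hadd hsmul₂ hsmul₁ habs₂ habs₁ hosc₂ hosc₁ hxI
    rw [hadd, Pi.add_apply, hsmul₂, hsmul₁, Pi.smul_apply, Pi.smul_apply, habs₂, habs₁, hosc₂,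
      hosc₁, Set.indicator_of_mem hxI, Set.indicator_of_mem hxI, smul_eq_mul, smul_eq_mul]
  have hgu : ∀ᵐ x, x ∈ (I : Set ℝ) → |g x - a₁ * a₂| ≤ |u x| := by
    filter_upwards [hg, hu, h₁] with x hgx hux hx₁ hxI
    calc |g x - a₁ * a₂| = |f₁ x * f₂ x - a₁ * a₂| := by rw [hgx]
      _ ≤ |f₁ x| * |f₂ x - a₂| + |a₂| * |f₁ x - a₁| := abs_mul_sub_mul_le _ _ _ _
      _ ≤ M₁ * |f₂ x - a₂| + M₂ * |f₁ x - a₁| := by gcongr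
      _ ≤ |u x| := hux hxI ▸ le_abs_self _
  calc |haarCoeff g I| ≤ ‖u‖ := abs_haarCoeff_le_norm_of_ae_abs_sub_le hgu
    _ ≤ ‖M₁ • |meanOscillation f₂ I|‖ + ‖M₂ • |meanOscillation f₁ I|‖ := norm_add_le _ _
    _ = M₁ * ‖meanOscillation f₂ I‖ + M₂ * ‖meanOscillation f₁ I‖ := by
        rw [norm_smul, norm_smul, norm_abs_eq_norm, norm_abs_eq_norm, Real.norm_of_nonneg hM₁,
          Real.norm_of_nonneg hM₂]

theorem mem_sobolev_and_norm_fracDeriv_sq_le_of_ae_eq_mul (hs : 0 < s) (hf₁ : f₁ ∈ D.sobolev s)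
    (hf₂ : f₂ ∈ D.sobolev s) (hg : g =ᵐ[volume] fun x => f₁ x * f₂ x)
    (h₁ : ∀ᵐ x, |f₁ x| ≤ M₁) (h₂ : ∀ᵐ x, |f₂ x| ≤ M₂) :
    g ∈ D.sobolev s ∧ ‖D.fracDeriv s g‖ ^ 2 ≤ 2 * (1 - (2 : ℝ) ^ (-2 * s))⁻¹ *
      (M₁ ^ 2 * ‖D.fracDeriv s f₂‖ ^ 2 + M₂ ^ 2 * ‖D.fracDeriv s f₁‖ ^ 2) := by
  have hterm : ∀ I : D.intervals, (volume.real (I : Set ℝ) ^ (-s) * haarCoeff g I) ^ 2 ≤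
      2 * (M₁ ^ 2 * (volume.real (I : Set ℝ) ^ (-s) * ‖meanOscillation f₂ I‖) ^ 2 +
        M₂ ^ 2 * (volume.real (I : Set ℝ) ^ (-s) * ‖meanOscillation f₁ I‖) ^ 2) := fun I => by
    have hcoeff := abs_haarCoeff_le_of_ae_eq_mul hg h₁ h₂ I
    calc (volume.real (I : Set ℝ) ^ (-s) * haarCoeff g I) ^ 2
        = (volume.real (I : Set ℝ) ^ (-s)) ^ 2 * |haarCoeff g I| ^ 2 := by
          rw [mul_pow, sq_abs]
      _ ≤ (volume.real (I : Set ℝ) ^ (-s)) ^ 2 *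
            (M₁ * ‖meanOscillation f₂ I‖ + M₂ * ‖meanOscillation f₁ I‖) ^ 2 := by gcongr
      _ ≤ (volume.real (I : Set ℝ) ^ (-s)) ^ 2 *
            (2 * ((M₁ * ‖meanOscillation f₂ I‖) ^ 2 + (M₂ * ‖meanOscillation f₁ I‖) ^ 2)) := by
          gcongr
          exact add_sq_le
      _ = _ := by ring
  have hsum := (((hasSum_weighted_norm_meanOscillation_sq hs hf₂).mul_left (M₁ ^ 2)).add
    ((hasSum_weighted_norm_meanOscillation_sq hs hf₁).mul_left (M₂ ^ 2))).mul_left 2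
  have hgs : g ∈ D.sobolev s :=
    mem_sobolev_iff_summable_sq.2 (hsum.summable.of_nonneg_of_le (fun I => sq_nonneg _) hterm)
  refine ⟨hgs, (hasSum_le hterm (hasSum_norm_fracDeriv_sq hgs) hsum).trans_eq ?_⟩
  ring

theorem exists_mem_sobolev_ae_eq_mul (hs : 1 / 2 < s) (hf₁ : f₁ ∈ D.sobolev s)
    (hf₂ : f₂ ∈ D.sobolev s) :
    ∃ g ∈ D.sobolev s, (g =ᵐ[volume] fun x => f₁ x * f₂ x) ∧
      D.sobolevNorm s g ≤ supConst s * √(4 * (1 - (2 : ℝ) ^ (-2 * s))⁻¹ + 1) *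
        D.sobolevNorm s f₁ * D.sobolevNorm s f₂ := by
  have hK := Real.rpow_lt_one_of_one_lt_of_neg one_lt_two (show -2 * s < 0 by linarith)
  have hA : 0 ≤ supConst s := zero_le_one.trans (one_le_supConst hs)
  have h₁ := ae_abs_le_supConst_mul_sobolevNorm hs hf₁
  have h₂ := ae_abs_le_supConst_mul_sobolevNorm hs hf₂
  obtain ⟨g, hg, hgnorm⟩ := exists_lp_ae_eq_mul_norm_le (Lp.aestronglyMeasurable f₁) h₁ f₂
  obtain ⟨hgs, hgD⟩ :=
    mem_sobolev_and_norm_fracDeriv_sq_le_of_ae_eq_mul (by linarith) hf₁ hf₂ hg h₁ h₂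
  set A := supConst s
  set N₁ := D.sobolevNorm s f₁
  set N₂ := D.sobolevNorm s f₂
  set K := (1 - (2 : ℝ) ^ (-2 * s))⁻¹
  have hK0 : 0 ≤ K := inv_nonneg.2 (sub_nonneg.2 hK.le)
  have hN₁0 : 0 ≤ N₁ := Real.sqrt_nonneg _
  have hN₂0 : 0 ≤ N₂ := Real.sqrt_nonneg _
  refine ⟨g, hgs, hg, (Real.sqrt_le_left (by positivity)).2 ?_⟩
  calc ‖D.fracDeriv s g‖ ^ 2 + ‖g‖ ^ 2
      ≤ 2 * K * ((A * N₁) ^ 2 * N₂ ^ 2 + (A * N₂) ^ 2 * N₁ ^ 2) + (A * N₁ * N₂) ^ 2 := by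
        refine add_le_add (hgD.trans ?_) ?_
        · gcongr
          · exact D.norm_fracDeriv_le_sobolevNorm s f₂
          · exact D.norm_fracDeriv_le_sobolevNorm s f₁
        · gcongr
          exact hgnorm.trans (by gcongr; exact D.norm_le_sobolevNorm s f₂)
    _ = (A * √(4 * K + 1) * N₁ * N₂) ^ 2 := by
        have hsqrt : √(4 * K + 1) ^ 2 = 4 * K + 1 := Real.sq_sqrt
          (add_nonneg (mul_nonneg zero_le_four hK0) zero_le_one)
        linear_combination -(A * N₁ * N₂) ^ 2 * hsqrt

end Product

end DyadicGrid

theorem mainTheorem1_general (s : ℝ) (hs : 1 / 2 < s) :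
    ∃ C : ℝ, 0 < C ∧ ∀ D : DyadicGrid, ∀ f₁ ∈ D.sobolev s, ∀ f₂ ∈ D.sobolev s,
      ∃ g ∈ D.sobolev s, (g =ᵐ[volume] fun x => f₁ x * f₂ x) ∧
        D.sobolevNorm s g ≤ C * D.sobolevNorm s f₁ * D.sobolevNorm s f₂ := by
  have hK := Real.rpow_lt_one_of_one_lt_of_neg one_lt_two (show -2 * s < 0 by linarith)
  have hK0 : 0 < (1 - (2 : ℝ) ^ (-2 * s))⁻¹ := inv_pos.2 (sub_pos.2 hK)
  exact ⟨_, mul_pos (zero_lt_one.trans_le (DyadicGrid.one_le_supConst hs))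
      (Real.sqrt_pos.2 (add_pos (mul_pos zero_lt_four hK0) zero_lt_one)),
    fun D f₁ hf₁ f₂ hf₂ => DyadicGrid.exists_mem_sobolev_ae_eq_mul hs hf₁ hf₂⟩

theorem mainTheorem1 (s : ℝ) (hs : 1 / 2 < s) (hs1 : s < 1) :
    ∃ C : ℝ, 0 < C ∧ ∀ D : DyadicGrid,
      (∀ f ∈ D.sobolev s, ∃ g ∈ D.sobolev s,
        (g =ᵐ[volume] fun x => f x ^ 2) ∧ D.sobolevNorm s g ≤ C * D.sobolevNorm s f ^ 2) ∧
      (∀ f₁ ∈ D.sobolev s, ∀ f₂ ∈ D.sobolev s, ∃ g ∈ D.sobolev s,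
        g =ᵐ[volume] fun x => f₁ x * f₂ x) := by
  obtain ⟨C, hC, hmul⟩ := mainTheorem1_general s hs
  refine ⟨C, hC, fun D => ⟨fun f hf => ?_, fun f₁ hf₁ f₂ hf₂ => ?_⟩⟩
  · simpa only [sq, mul_assoc] using hmul D f hf f hf
  · exact (hmul D f₁ hf₁ f₂ hf₂).imp fun g hg => ⟨hg.1, hg.2.1⟩
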